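/- Assume the Riemann hypothesis, and let $\delta>0$ and $p>1$ be real numbers. Then, as $T\to\infty$, \[ \int_T^{T+\delta} |\zeta(1+it)|^{p}\,dt = O\!\left(\log\log\log T\,(\log\log T)^{p-1}\right) \quad\text{and}\quad \int_T^{T+\delta} |\zeta(1+it)|^{-p}\,dt = O\!\left(\log\log\log T\,(\log\log T)^{p-1}\right), \] where $\zeta$ is the Riemann zeta-function and the implied constants may depend on $\delta$ and $p$. -/

import Mathlib

/-!
# Moments of `ζ(1 + i t)` over short intervals

Write `L = log log T`. On the Riemann hypothesis the moments of `|ζ(1 + i t)|` and of its inverse of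
order `p > 1` over `[T, T + δ]` are in fact `O(L ^ (p - 1))`, which is the size of
`∫ |1 / L + i u| ^ (-p) du`, that is, of the same moment near the pole on the line
`re s = 1 + 1 / L`. Two steps reduce the claim to that computation.

The first step moves the line of integration from `1` to `1 + 1 / L`. By the Borel–Carathéodory
theorem, a nonvanishing `ζ` of polynomial growth has `ζ' / ζ = O(log T) = O(exp L)` a fixed distance
to the left of `re s = 1`, while `ζ' / ζ = O(L)` for `re s ≥ 1 + 1 / L` by absolute convergence. Since
the second region is at distance `1 / L` from the line `re s = 1`, Hadamard's three circles theorem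
gives `ζ' / ζ = O(L)` there as well (`RiemannHypothesis.exists_norm_logDeriv_le`). Integrated over a
segment of length `1 / L`, this changes `log |ζ|` by `O(1)`
(`RiemannHypothesis.exists_norm_riemannZeta_compare`).

The second step moves the interval from height `T` to the real axis, on the line
`re s = σ = 1 + 1 / L`. There `log |ζ|` is, up to `O(1)`, a trigonometric polynomial
`∑ c_n cos (u log n)` with `c_n ≥ 0`. Expanding the exponential and using that
`(x, y) ↦ exp (i μ (x - y))` is positive definite, one sees that in the mean over `u = x - y` the
exponential of such a sum only grows when arbitrary phases, signs included, are replaced by aligned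
ones (`integral_prod_exp_trigPoly_le`). Hence both `|ζ(σ + i u)| ^ p` and `|ζ(σ + i u)| ^ (-p)` have
means over `[T, T + δ]` bounded by a constant times the mean of `|ζ(σ + i u)| ^ p` over
`[-2 δ, 2 δ]` (`integral_norm_riemannZeta_rpow_le`). The pole of `ζ` determines the latter
(`exists_integral_norm_riemannZeta_rpow_le`).
-/

open Complex Filter Topology Set MeasureTheory

/-! ### Growth of `ζ` in the half-plane `re s ≥ 1 / 2` -/

/-- The `n`-th term of the series `∑ ((n+1)^{-s} - ∫_{n+1}^{n+2} x^{-s} dx)`, which represents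
`ζ(s) - 1 / (s - 1)` in the half-plane `0 < re s`; the integral is written in closed form. -/
noncomputable def zetaDefect (n : ℕ) (s : ℂ) : ℂ :=
  ((n + 1 : ℕ) : ℂ) ^ (-s) -
    (((n + 2 : ℕ) : ℂ) ^ (1 - s) - ((n + 1 : ℕ) : ℂ) ^ (1 - s)) / (1 - s)

/-- Two applications of the mean value inequality: `x ^ (-s)` varies by at most
`‖s‖ * (n + 1) ^ (-re s - 1)` on `[n + 1, n + 2]`. -/
lemma norm_zetaDefect_le (n : ℕ) {s : ℂ} (hs : 0 ≤ s.re) (hs1 : s ≠ 1) :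
    ‖zetaDefect n s‖ ≤ ‖s‖ * ((n + 1 : ℕ) : ℝ) ^ (-s.re - 1) := by
  set a : ℝ := ((n + 1 : ℕ) : ℝ) with ha
  have ha0 : 0 < a := by rw [ha]; positivity
  have hs1' : 1 - s ≠ 0 := sub_ne_zero.mpr (Ne.symm hs1)
  have hcpow : ∀ x ∈ Icc a (a + 1), ‖(x : ℂ) ^ (-s) - (a : ℂ) ^ (-s)‖ ≤
      ‖s‖ * a ^ (-s.re - 1) := by
    intro x hx
    have h := Convex.norm_image_sub_le_of_norm_hasDerivWithin_le (𝕜 := ℝ)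
      (f := fun x : ℝ => (x : ℂ) ^ (-s)) (f' := fun x : ℝ => -s * (x : ℂ) ^ (-s - 1))
      (s := Icc a (a + 1)) (C := ‖s‖ * a ^ (-s.re - 1)) (x := a) (y := x) ?_ ?_
      (convex_Icc _ _) ⟨le_rfl, by linarith⟩ hx
    · refine h.trans ?_
      rw [Real.norm_of_nonneg (by linarith [hx.1])]
      exact mul_le_of_le_one_right (by positivity) (by linarith [hx.2])
    · intro y hy
      rcases eq_or_ne s 0 with rfl | hs0
      · simpa using (hasDerivWithinAt_const y _ (1 : ℂ))
      · have hy0 : 0 < y := by linarith [hy.1]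
        exact (hasDerivAt_ofReal_cpow_const hy0.ne' (neg_ne_zero.mpr hs0)).hasDerivWithinAt
    · intro y hy
      have hy0 : 0 < y := by linarith [hy.1]
      rw [norm_mul, norm_neg, norm_cpow_eq_rpow_re_of_pos hy0]
      gcongr
      simp only [sub_re, neg_re, one_re]
      exact Real.rpow_le_rpow_of_nonpos ha0 hy.1 (by linarith)
  have key := Convex.norm_image_sub_le_of_norm_hasDerivWithin_le (𝕜 := ℝ)
      (f := fun x : ℝ => (x : ℂ) * (a : ℂ) ^ (-s) - (x : ℂ) ^ (1 - s) / (1 - s))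
      (f' := fun x : ℝ => (a : ℂ) ^ (-s) - (x : ℂ) ^ (-s))
      (s := Icc a (a + 1)) (C := ‖s‖ * a ^ (-s.re - 1)) (x := a) (y := a + 1) ?_ ?_
      (convex_Icc _ _) ⟨le_rfl, by linarith⟩ ⟨by linarith, le_rfl⟩
  · have e : a + 1 - a = 1 := by ring
    rw [e, norm_one, mul_one] at key
    refine le_trans (le_of_eq ?_) key
    congr 1
    rw [zetaDefect, ha]
    push_cast
    field_simp
    ring_nf
  · intro y hy
    have hy0 : 0 < y := by linarith [hy.1]
    have h1 : HasDerivAt (fun x : ℝ => (x : ℂ) * (a : ℂ) ^ (-s)) ((a : ℂ) ^ (-s)) y := by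
      simpa using (Complex.ofRealCLM.hasDerivAt (x := y)).mul_const ((a : ℂ) ^ (-s))
    have h2 := (hasDerivAt_ofReal_cpow_const hy0.ne' hs1').div_const (1 - s)
    rw [mul_div_cancel_left₀ _ hs1', show 1 - s - 1 = -s by ring] at h2
    exact (h1.sub h2).hasDerivWithinAt
  · intro y hy
    rw [norm_sub_rev]
    exact hcpow y hy

lemma differentiableAt_zetaDefect (n : ℕ) {s : ℂ} (hs1 : s ≠ 1) :
    DifferentiableAt ℂ (zetaDefect n) s := by
  have hs1' : 1 - s ≠ 0 := sub_ne_zero.mpr (Ne.symm hs1)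
  have h (m : ℕ) (hm : m ≠ 0) (g : ℂ → ℂ) (hg : DifferentiableAt ℂ g s) :
      DifferentiableAt ℂ (fun z => (m : ℂ) ^ g z) s :=
    hg.const_cpow (Or.inl (by exact_mod_cast hm))
  unfold zetaDefect
  refine (h _ (by lia) _ (by fun_prop)).sub (DifferentiableAt.div ?_ (by fun_prop) hs1')
  exact (h _ (by lia) _ (by fun_prop)).sub (h _ (by lia) _ (by fun_prop))

lemma summable_natCast_succ_rpow {σ : ℝ} (hσ : 0 < σ) :
    Summable fun n : ℕ => ((n + 1 : ℕ) : ℝ) ^ (-σ - 1) :=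
  (summable_nat_add_iff 1).mpr (Real.summable_nat_rpow.mpr (by linarith))

lemma summable_zetaDefect {s : ℂ} (hs : 0 < s.re) (hs1 : s ≠ 1) :
    Summable fun n => zetaDefect n s :=
  .of_norm_bounded ((summable_natCast_succ_rpow hs).mul_left ‖s‖)
    fun n => norm_zetaDefect_le n hs.le hs1

lemma tsum_zetaDefect_of_one_lt_re {s : ℂ} (hs : 1 < s.re) :
    ∑' n, zetaDefect n s = riemannZeta s - 1 / (s - 1) := by
  have hs1 : s ≠ 1 := by rintro rfl; simp at hs
  have hs1' : 1 - s ≠ 0 := sub_ne_zero.mpr (Ne.symm hs1)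
  have h1 := (summable_zetaDefect (by linarith) hs1).hasSum.tendsto_sum_nat
  have hz : Summable fun n : ℕ => ((n + 1 : ℕ) : ℂ) ^ (-s) := by
    have := (summable_nat_add_iff 1).mpr (Complex.summable_one_div_nat_cpow.mpr hs)
    simpa [cpow_neg] using this
  have h2 := hz.hasSum.tendsto_sum_nat
  have hzv : ∑' n : ℕ, ((n + 1 : ℕ) : ℂ) ^ (-s) = riemannZeta s := by
    rw [zeta_eq_tsum_one_div_nat_add_one_cpow hs]
    simp [cpow_neg]
  rw [hzv] at h2
  have h3 : Tendsto (fun N : ℕ => (((N + 1 : ℕ) : ℂ) ^ (1 - s) - 1) / (1 - s)) atTop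
      (𝓝 ((0 - 1) / (1 - s))) := by
    refine (Tendsto.sub_const ?_ _).div_const _
    rw [tendsto_zero_iff_norm_tendsto_zero]
    have h4 : Tendsto (fun N : ℕ => ((N + 1 : ℕ) : ℝ) ^ (-(s.re - 1))) atTop (𝓝 0) :=
      ((tendsto_rpow_neg_atTop (by linarith)).comp tendsto_natCast_atTop_atTop).comp
        (tendsto_add_atTop_nat 1)
    refine h4.congr fun N => ?_
    rw [norm_natCast_cpow_of_pos (by lia)]
    simp
  have h5 := tendsto_nhds_unique h1 ((h2.sub h3).congr fun N => ?_)
  · rw [h5]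
    have : s - 1 ≠ 0 := sub_ne_zero.mpr hs1
    grind
  · induction N with
    | zero => simp
    | succ N ih =>
      rw [Finset.sum_range_succ, Finset.sum_range_succ, ← ih, zetaDefect]
      push_cast
      ring_nf

/-- The continuation of `tsum_zetaDefect_of_one_lt_re` to `0 < re s`. The quadrant `0 < im s` avoids
the pole and is convex, which is all that the identity theorem needs. -/
lemma tsum_zetaDefect {s : ℂ} (hs : 0 < s.re) (hs' : 0 < s.im) :
    ∑' n, zetaDefect n s = riemannZeta s - 1 / (s - 1) := by
  set U : Set ℂ := {z | 0 < z.re} ∩ {z | 0 < z.im} with hU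
  have hUo : IsOpen U :=
    (isOpen_lt continuous_const continuous_re).inter (isOpen_lt continuous_const continuous_im)
  have hUc : IsPreconnected U :=
    ((convex_halfSpace_re_gt 0).inter (convex_halfSpace_im_gt 0)).isPreconnected
  have hne : ∀ z ∈ U, z ≠ 1 := by
    rintro z hz rfl
    simpa using hz.2
  have hd1 : DifferentiableOn ℂ (fun z => ∑' n, zetaDefect n z) U := by
    intro z hz
    refine DifferentiableAt.differentiableWithinAt ?_
    -- Near `z` the terms are dominated by a fixed summable sequence, as `re z / 2 < re w`.
    set V : Set ℂ := {w | z.re / 2 < w.re} ∩ ({w | 0 < w.im} ∩ Metric.ball 0 (‖z‖ + 1)) with hV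
    have hVo : IsOpen V := (isOpen_lt continuous_const continuous_re).inter
      ((isOpen_lt continuous_const continuous_im).inter Metric.isOpen_ball)
    have hzp : 0 < z.re := hz.1
    have hzV : z ∈ V := ⟨by change z.re / 2 < z.re; linarith, hz.2, by simp⟩
    have hVU : V ⊆ U := by
      refine fun w hw => ⟨?_, hw.2.1⟩
      have : z.re / 2 < w.re := hw.1
      change 0 < w.re
      linarith
    refine (differentiableOn_tsum_of_summable_norm
      (u := fun n => (‖z‖ + 1) * ((n + 1 : ℕ) : ℝ) ^ (-(z.re / 2) - 1))
      ((summable_natCast_succ_rpow (by linarith)).mul_left _)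
      (fun n w hw => (differentiableAt_zetaDefect n (hne w (hVU hw))).differentiableWithinAt)
      hVo fun n w hw => ?_).differentiableAt (hVo.mem_nhds hzV)
    have hw1 : z.re / 2 < w.re := hw.1
    have hw2 : ‖w‖ < ‖z‖ + 1 := by simpa using hw.2.2
    refine (norm_zetaDefect_le n (by linarith) (hne w (hVU hw))).trans ?_
    gcongr
    simp
  have hd2 : DifferentiableOn ℂ (fun z => riemannZeta z - 1 / (z - 1)) U := fun z hz => by
    have h1 := hne z hz
    have h2 : z - 1 ≠ 0 := sub_ne_zero.mpr h1
    have h3 := differentiableAt_riemannZeta h1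
    exact DifferentiableAt.differentiableWithinAt (by fun_prop (disch := assumption))
  have hmem : (2 + I : ℂ) ∈ U := by simp [hU]
  refine (hd1.analyticOnNhd hUo).eqOn_of_preconnected_of_eventuallyEq (hd2.analyticOnNhd hUo)
    hUc hmem ?_ ⟨hs, hs'⟩
  filter_upwards [(isOpen_lt continuous_const continuous_re).mem_nhds
    (show (1 : ℝ) < (2 + I : ℂ).re by simp)] with z hz
  exact tsum_zetaDefect_of_one_lt_re hz

/-- Linear growth of the zeta function to the right of the critical line. -/
lemma exists_norm_riemannZeta_le :
    ∃ K : ℝ, 0 < K ∧ ∀ s : ℂ, 1 / 2 ≤ s.re → 1 / 2 ≤ s.im → ‖riemannZeta s‖ ≤ K * ‖s‖ := by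
  have hsum := summable_natCast_succ_rpow (σ := 1 / 2) (by norm_num)
  have hS : 0 ≤ ∑' n : ℕ, ((n + 1 : ℕ) : ℝ) ^ (-(1 / 2 : ℝ) - 1) :=
    tsum_nonneg fun n => by positivity
  refine ⟨4 + ∑' n : ℕ, ((n + 1 : ℕ) : ℝ) ^ (-(1 / 2 : ℝ) - 1), by positivity, fun s hs hs' => ?_⟩
  have h := tsum_zetaDefect (s := s) (by linarith) (by linarith)
  have hs1 : s ≠ 1 := by rintro rfl; norm_num at hs'
  have hb : ‖∑' n, zetaDefect n s‖ ≤ ‖s‖ * ∑' n : ℕ, ((n + 1 : ℕ) : ℝ) ^ (-(1 / 2 : ℝ) - 1) := by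
    rw [← tsum_mul_left]
    refine tsum_of_norm_bounded (hsum.mul_left _).hasSum fun n => ?_
    refine (norm_zetaDefect_le n (by linarith) hs1).trans ?_
    gcongr
    simp
  have h1 : ‖1 / (s - 1)‖ ≤ 2 := by
    have : 1 / 2 ≤ ‖s - 1‖ := by
      have := abs_im_le_norm (s - 1)
      simp only [sub_im, one_im, sub_zero] at this
      linarith [le_abs_self s.im]
    rw [norm_div, norm_one, div_le_iff₀ (by linarith)]
    linarith
  have h2 : 1 / 2 ≤ ‖s‖ := hs.trans (re_le_norm s)
  have h3 : riemannZeta s = ∑' n, zetaDefect n s + 1 / (s - 1) := by rw [h]; ring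
  rw [h3]
  refine (norm_add_le _ _).trans ?_
  linarith

/-! ### Logarithms on discs and the three circles theorem -/

/-- A nonvanishing holomorphic function on a disc has a holomorphic logarithm there. -/
lemma exists_eq_mul_exp_of_ball {f : ℂ → ℂ} {c : ℂ} {R : ℝ} (hR : 0 < R)
    (hf : DifferentiableOn ℂ f (Metric.ball c R)) (h0 : ∀ z ∈ Metric.ball c R, f z ≠ 0) :
    ∃ g : ℂ → ℂ, g c = 0 ∧ ∀ z ∈ Metric.ball c R,
      HasDerivAt g (logDeriv f z) z ∧ f z = f c * exp (g z) := by
  have hld : DifferentiableOn ℂ (logDeriv f) (Metric.ball c R) :=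
    (hf.deriv Metric.isOpen_ball).div hf h0
  obtain ⟨g, hgc, hg⟩ := hld.isExactOn_ball.with_val_at c 0
  have hc : c ∈ Metric.ball c R := Metric.mem_ball_self hR
  refine ⟨g, hgc, fun z hz => ⟨hg z hz, ?_⟩⟩
  have hconst : ∀ w ∈ Metric.ball c R, HasDerivAt (fun w => f w * exp (-g w)) 0 w := by
    intro w hw
    have h1 := (hf.differentiableAt (Metric.isOpen_ball.mem_nhds hw)).hasDerivAt
    refine (h1.mul (hg w hw).neg.cexp).congr_deriv ?_
    have := h0 w hw
    simp only [logDeriv_apply]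
    field_simp
    ring
  have h2 := (convex_ball c R).is_const_of_fderivWithin_eq_zero (𝕜 := ℂ)
    (f := fun w => f w * exp (-g w))
    (fun w hw => (hconst w hw).differentiableAt.differentiableWithinAt)
    (fun w hw => by
      rw [fderivWithin_of_isOpen Metric.isOpen_ball hw]
      ext
      simp [(hconst w hw).hasFDerivAt.fderiv]) hc hz
  simp only [hgc, neg_zero, exp_zero, mul_one] at h2
  rw [h2, mul_assoc, ← exp_add]
  simp

/-- If `log |f|` exceeds its value at the centre of a disc by at most `M`, then `f' / f` is bounded
by a multiple of `M` on smaller discs (Borel–Carathéodory for `log f`, then Cauchy's estimate). -/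
lemma norm_logDeriv_le_of_norm_le {f : ℂ → ℂ} {c : ℂ} {r ρ R M : ℝ} (hr : 0 ≤ r) (hrρ : r < ρ)
    (hρR : ρ < R) (hM : 0 < M) (hf : DifferentiableOn ℂ f (Metric.ball c R))
    (h0 : ∀ z ∈ Metric.ball c R, f z ≠ 0)
    (hfM : ∀ z ∈ Metric.ball c R, ‖f z‖ ≤ ‖f c‖ * Real.exp M) {z : ℂ}
    (hz : z ∈ Metric.closedBall c r) :
    ‖logDeriv f z‖ ≤ 2 * M * ρ / (R - ρ) / (ρ - r) := by
  obtain ⟨g, hgc, hg⟩ := exists_eq_mul_exp_of_ball (by linarith) hf h0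
  have hc : c ∈ Metric.ball c R := Metric.mem_ball_self (by linarith)
  have hre : ∀ w ∈ Metric.ball c R, (g w).re ≤ M := by
    intro w hw
    have h1 := hfM w hw
    rw [(hg w hw).2, norm_mul, norm_exp] at h1
    exact Real.exp_le_exp.mp (le_of_mul_le_mul_left h1 (norm_pos_iff.mpr (h0 c hc)))
  have hmaps : ∀ w ∈ Metric.ball (0 : ℂ) R, c + w ∈ Metric.ball c R := by
    intro w hw
    simpa using hw
  have hbd : ∀ w ∈ Metric.closedBall c ρ, ‖g w‖ ≤ 2 * M * ρ / (R - ρ) := by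
    intro w hw
    have hw' : ‖w - c‖ ≤ ρ := by simpa [dist_eq_norm] using hw
    have h1 := borelCaratheodory_zero (f := fun u => g (c + u)) (R := R) (z := w - c) hM ?_
      (fun u hu => hre _ (hmaps u hu)) (by linarith) (by simpa using hw'.trans_lt hρR)
      (by simpa using hgc)
    · simp only [add_sub_cancel] at h1
      refine h1.trans ?_
      have : 0 < R - ‖w - c‖ := by linarith
      have : 0 < R - ρ := by linarith
      have : 0 ≤ ρ := by linarith
      gcongr
    · intro u hu
      exact ((hg _ (hmaps u hu)).1.differentiableAt.comp u
        (differentiableAt_id.const_add c)).differentiableWithinAt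
  have hzr : dist z c ≤ r := hz
  have hzR : z ∈ Metric.ball c R := Metric.mem_ball.mpr (by linarith)
  rw [← (hg z hzR).1.deriv]
  have hsub : Metric.closedBall z (ρ - r) ⊆ Metric.closedBall c ρ :=
    Metric.closedBall_subset_closedBall' (by linarith)
  refine norm_deriv_le_of_forall_mem_sphere_norm_le (by linarith) ?_
    fun w hw => hbd w (hsub (Metric.sphere_subset_closedBall hw))
  refine DifferentiableOn.diffContOnCl (s := Metric.ball z (ρ - r)) ?_
  rw [closure_ball _ (by linarith)]
  intro w hw
  have : w ∈ Metric.ball c R := Metric.closedBall_subset_ball hρR (hsub hw)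
  exact (hg w this).1.differentiableAt.differentiableWithinAt

/-- **Hadamard's three circles theorem**: the three lines theorem for `z ↦ f (c + exp z)`. -/
lemma norm_le_of_three_circles {f : ℂ → ℂ} {c z : ℂ} {r₁ r₂ a b : ℝ} (hr₁ : 0 < r₁)
    (hr : r₁ < r₂) (hf : ∀ w ∈ Metric.closedBall c r₂, DifferentiableAt ℂ f w)
    (ha : ∀ w ∈ Metric.sphere c r₁, ‖f w‖ ≤ a) (hb : ∀ w ∈ Metric.sphere c r₂, ‖f w‖ ≤ b)
    (hz₁ : r₁ ≤ ‖z - c‖) (hz₂ : ‖z - c‖ ≤ r₂) :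
    ‖f z‖ ≤ a ^ (1 - Real.log (‖z - c‖ / r₁) / Real.log (r₂ / r₁)) *
      b ^ (Real.log (‖z - c‖ / r₁) / Real.log (r₂ / r₁)) := by
  have hr₂ : 0 < r₂ := hr₁.trans hr
  have hzc : 0 < ‖z - c‖ := hr₁.trans_le hz₁
  have hexp : ∀ w ∈ HadamardThreeLines.verticalClosedStrip (Real.log r₁) (Real.log r₂),
      c + exp w ∈ Metric.closedBall c r₂ := by
    intro w hw
    have : w.re ≤ Real.log r₂ := hw.2
    simpa [norm_exp] using (Real.le_log_iff_exp_le hr₂).mp this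
  have hlog : exp (log (z - c)) = z - c := exp_log (norm_pos_iff.mp hzc)
  have hd : ∀ w ∈ HadamardThreeLines.verticalClosedStrip (Real.log r₁) (Real.log r₂),
      DifferentiableAt ℂ (fun w => f (c + exp w)) w := fun w hw =>
    (hf _ (hexp w hw)).comp w (differentiableAt_exp.const_add c)
  have h := HadamardThreeLines.norm_le_interp_of_mem_verticalClosedStrip'
    (f := fun w => f (c + exp w)) (z := log (z - c)) (a := a) (b := b)
    (Real.log_lt_log hr₁ hr) ?_ ?_ ?_ ?_ ?_
  · simp only [hlog, log_re, add_sub_cancel] at h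
    rwa [Real.log_div hzc.ne' hr₁.ne', Real.log_div hr₂.ne' hr₁.ne']
  · simp only [HadamardThreeLines.verticalClosedStrip, mem_preimage, log_re]
    exact ⟨Real.log_le_log hr₁ hz₁, Real.log_le_log hzc hz₂⟩
  · refine DifferentiableOn.diffContOnCl fun w hw => (hd w ?_).differentiableWithinAt
    rwa [HadamardThreeLines.verticalStrip, closure_preimage_re,
      closure_Ioo (Real.log_lt_log hr₁ hr).ne] at hw
  · obtain ⟨B, hB⟩ := (isCompact_closedBall c r₂).bddAbove_image (f := fun w => ‖f w‖)
      fun w hw => (hf w hw).continuousAt.norm.continuousWithinAt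
    refine ⟨B, ?_⟩
    rintro _ ⟨w, hw, rfl⟩
    exact hB ⟨_, hexp w hw, rfl⟩
  · intro w hw
    have : w.re = Real.log r₁ := hw
    exact ha _ (by simp [norm_exp, this, Real.exp_log hr₁])
  · intro w hw
    have : w.re = Real.log r₂ := hw
    exact hb _ (by simp [norm_exp, this, Real.exp_log hr₂])

/-! ### The Dirichlet series of `log ζ` and `ζ' / ζ` -/

/-- The coefficients `Λ(n) / log n` of the Dirichlet series of `log ζ`. -/
noncomputable def logZetaCoeff (n : ℕ) : ℝ := ArithmeticFunction.vonMangoldt n / Real.log n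

lemma logZetaCoeff_nonneg (n : ℕ) : 0 ≤ logZetaCoeff n :=
  div_nonneg ArithmeticFunction.vonMangoldt_nonneg (Real.log_natCast_nonneg n)

lemma logZetaCoeff_le_one (n : ℕ) : logZetaCoeff n ≤ 1 :=
  div_le_one_of_le₀ ArithmeticFunction.vonMangoldt_le_log (Real.log_natCast_nonneg n)

lemma lseriesSummable_logZetaCoeff {s : ℂ} (hs : 1 < s.re) :
    LSeriesSummable (fun n => (logZetaCoeff n : ℂ)) s :=
  LSeriesSummable_of_bounded_of_one_lt_re (m := 1) (fun n _ => by
    rw [norm_real, Real.norm_of_nonneg (logZetaCoeff_nonneg n)]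
    exact logZetaCoeff_le_one n) hs

lemma norm_riemannZeta_eq_exp {s : ℂ} (hs : 1 < s.re) :
    ‖riemannZeta s‖ = Real.exp (LSeries (fun n => (logZetaCoeff n : ℂ)) s).re := by
  rw [← riemannZeta_eq_exp_LSeries hs, norm_exp]
  simp [logZetaCoeff]

/-- `|ζ|` is bounded below on the line `re s = 2`. -/
lemma exists_one_le_norm_riemannZeta_mul_exp :
    ∃ K : ℝ, 0 ≤ K ∧ ∀ t : ℝ, 1 ≤ ‖riemannZeta (2 + I * t)‖ * Real.exp K := by
  refine ⟨∑' n, ‖LSeries.term (fun n => (logZetaCoeff n : ℂ)) 2 n‖,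
    tsum_nonneg fun n => norm_nonneg _, fun t => ?_⟩
  have hre : (2 + I * t : ℂ).re = 2 := by simp
  have hs : 1 < (2 + I * t : ℂ).re := by rw [hre]; norm_num
  rw [norm_riemannZeta_eq_exp hs, ← Real.exp_add, Real.one_le_exp_iff]
  have h1 : ‖LSeries (fun n => (logZetaCoeff n : ℂ)) (2 + I * t)‖ ≤
      ∑' n, ‖LSeries.term (fun n => (logZetaCoeff n : ℂ)) 2 n‖ := by
    refine tsum_of_norm_bounded
      ((lseriesSummable_logZetaCoeff (s := 2) (by norm_num)).norm).hasSum fun n => ?_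
    exact LSeries.norm_term_le_of_re_le_re _ (by rw [hre]; simp) n
  linarith [neg_le_of_abs_le (abs_re_le_norm (LSeries (fun n => (logZetaCoeff n : ℂ)) (2 + I * t)))]

/-- To the right of `1 + η` the Dirichlet series of `ζ' / ζ` is dominated by its value at the real
point `1 + η`, which is governed by the pole of `ζ`. -/
lemma exists_norm_logDeriv_riemannZeta_le_of_one_add_le :
    ∃ η₀ : ℝ, 0 < η₀ ∧ ∀ η : ℝ, 0 < η → η < η₀ → ∀ s : ℂ, 1 + η ≤ s.re →
      ‖logDeriv riemannZeta s‖ ≤ 2 / η := by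
  obtain ⟨C, hC, hb⟩ := log_deriv_riemannZeta_add_inv_sub_bounded.exists_pos
  rw [Asymptotics.IsBigOWith, eventually_nhdsWithin_iff, Metric.eventually_nhds_iff] at hb
  obtain ⟨ε, hε, hb⟩ := hb
  refine ⟨min ε (1 / C), lt_min hε (by positivity), fun η hη hη' s hs => ?_⟩
  have hlog : ∀ s : ℂ, 1 < s.re → logDeriv riemannZeta s =
      -LSeries (fun n => (ArithmeticFunction.vonMangoldt n : ℂ)) s := by
    intro s hs
    rw [ArithmeticFunction.LSeries_vonMangoldt_eq_deriv_riemannZeta_div hs, logDeriv_apply]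
    ring
  set σ : ℂ := ((1 + η : ℝ) : ℂ) with hσ
  have hσre : σ.re = 1 + η := by simp [hσ]
  have hsum : Summable fun n =>
      ‖LSeries.term (fun n => (ArithmeticFunction.vonMangoldt n : ℂ)) σ n‖ :=
    (ArithmeticFunction.LSeriesSummable_vonMangoldt (s := σ) (by rw [hσre]; linarith)).norm
  have h1 : ‖logDeriv riemannZeta s‖ ≤
      ∑' n, ‖LSeries.term (fun n => (ArithmeticFunction.vonMangoldt n : ℂ)) σ n‖ := by
    rw [hlog s (by linarith), norm_neg]
    refine tsum_of_norm_bounded hsum.hasSum fun n => ?_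
    exact LSeries.norm_term_le_of_re_le_re _ (by rw [hσre]; exact hs) n
  have h2 : ((∑' n, ‖LSeries.term (fun n => (ArithmeticFunction.vonMangoldt n : ℂ)) σ n‖ : ℝ) : ℂ)
      = LSeries (fun n => (ArithmeticFunction.vonMangoldt n : ℂ)) σ := by
    rw [ofReal_tsum, LSeries]
    refine tsum_congr fun n => ?_
    rcases eq_or_ne n 0 with rfl | hn
    · simp
    · rw [LSeries.norm_term_eq, if_neg hn, LSeries.term_of_ne_zero hn, hσre, norm_real,
        Real.norm_of_nonneg ArithmeticFunction.vonMangoldt_nonneg, hσ, ofReal_div,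
        ofReal_cpow n.cast_nonneg]
      simp
  have h3 : ∑' n, ‖LSeries.term (fun n => (ArithmeticFunction.vonMangoldt n : ℂ)) σ n‖ =
      ‖logDeriv riemannZeta σ‖ := by
    rw [hlog σ (by rw [hσre]; linarith), norm_neg, ← h2, norm_real,
      Real.norm_of_nonneg (tsum_nonneg fun n => norm_nonneg _)]
  have hσ1 : σ - 1 = (η : ℂ) := by rw [hσ]; push_cast; ring
  have h4 := hb (y := σ)
    (by rw [dist_eq_norm, hσ1, norm_real, Real.norm_of_nonneg hη.le]
        exact hη'.trans_le (min_le_left _ _))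
    (by
      intro h
      rw [mem_singleton_iff] at h
      rw [h, sub_self] at hσ1
      exact hη.ne (by exact_mod_cast hσ1))
  rw [← logDeriv_apply, hσ1, norm_one, mul_one] at h4
  have h5 : ‖logDeriv riemannZeta σ‖ ≤ C + 1 / η := by
    have e : logDeriv riemannZeta σ = (logDeriv riemannZeta σ + (η : ℂ)⁻¹) - (η : ℂ)⁻¹ := by ring
    rw [e]
    refine (norm_sub_le _ _).trans (add_le_add h4 ?_)
    rw [norm_inv, norm_real, Real.norm_of_nonneg hη.le, one_div]
  have h6 : C ≤ 1 / η := by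
    rw [le_div_iff₀ hη]
    have := (lt_div_iff₀ hC).mp (hη'.trans_le (min_le_right _ _))
    linarith
  calc _ ≤ C + 1 / η := by linarith
    _ ≤ 1 / η + 1 / η := by linarith
    _ = 2 / η := by ring

/-! ### `ζ' / ζ` near the line `re s = 1` on the Riemann hypothesis -/

lemma RiemannHypothesis.riemannZeta_ne_zero (hRH : RiemannHypothesis) {s : ℂ}
    (hs : 1 / 2 < s.re) (hs1 : s ≠ 1) : riemannZeta s ≠ 0 := by
  intro h
  have h2 := hRH s h (by
    rintro ⟨n, rfl⟩
    have : (-2 * ((n : ℂ) + 1)).re = -2 * ((n : ℝ) + 1) := by simp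
    rw [this] at hs
    have : (0 : ℝ) ≤ n := n.cast_nonneg
    linarith) hs1
  linarith

/-- On the Riemann hypothesis the discs of radius `4 / 3` about `2 + i t` contain no zeros, so the
linear growth of `ζ` gives a logarithmic bound for `ζ' / ζ` on the discs of radius `7 / 6`. -/
lemma RiemannHypothesis.exists_norm_logDeriv_le_log (hRH : RiemannHypothesis) :
    ∃ C : ℝ, 1 ≤ C ∧ ∀ t : ℝ, 3 ≤ t → ∀ s ∈ Metric.closedBall (2 + I * t) (7 / 6),
      ‖logDeriv riemannZeta s‖ ≤ C * Real.log t := by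
  obtain ⟨K, hK, hζ⟩ := exists_norm_riemannZeta_le
  obtain ⟨K₂, hK₂, hζ₂⟩ := exists_one_le_norm_riemannZeta_mul_exp
  set A : ℝ := Real.log (3 * K + 1) + K₂ + 1 with hA
  have hlogK : 0 ≤ Real.log (3 * K + 1) := Real.log_nonneg (by linarith)
  refine ⟨360 * A, by linarith, fun t ht s hs => ?_⟩
  have hlogt : 1 ≤ Real.log t := by
    rw [Real.le_log_iff_exp_le (by linarith)]
    linarith [Real.exp_one_lt_d9]
  have hball : ∀ z ∈ Metric.ball (2 + I * t : ℂ) (4 / 3),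
      2 / 3 < z.re ∧ 1 / 2 < z.im ∧ ‖z‖ ≤ 3 * t := by
    intro z hz
    rw [Metric.mem_ball, dist_eq_norm] at hz
    have h1 := (abs_re_le_norm (z - (2 + I * t))).trans_lt hz
    have h2 := (abs_im_le_norm (z - (2 + I * t))).trans_lt hz
    simp only [sub_re, add_re, re_ofNat, mul_re, I_re, ofReal_re, zero_mul, I_im, ofReal_im,
      mul_zero, sub_zero, add_zero, sub_im, add_im, im_ofNat, mul_im, one_mul, zero_add] at h1 h2
    rw [abs_lt] at h1 h2
    refine ⟨by linarith, by linarith, ?_⟩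
    have h3 : ‖z‖ ≤ ‖z - (2 + I * t)‖ + ‖(2 + I * t : ℂ)‖ := norm_le_norm_sub_add _ _
    have h4 : ‖(2 + I * t : ℂ)‖ ≤ 2 + t := by
      refine (norm_add_le _ _).trans ?_
      simp [abs_of_nonneg (by linarith : 0 ≤ t)]
    linarith
  have hne1 : ∀ z ∈ Metric.ball (2 + I * t : ℂ) (4 / 3), z ≠ 1 := by
    rintro z hz rfl
    have := (hball 1 hz).2.1
    norm_num at this
  -- `A` is chosen so that `|ζ| ≤ |ζ(2 + i t)| * exp (A * log t)` on the disc.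
  have hMpos : 0 < A * Real.log t := by positivity
  have h := norm_logDeriv_le_of_norm_le (f := riemannZeta) (c := 2 + I * t) (r := 7 / 6)
    (ρ := 5 / 4) (R := 4 / 3) (M := A * Real.log t) (by norm_num) (by norm_num) (by norm_num) hMpos
    (fun z hz => (differentiableAt_riemannZeta (hne1 z hz)).differentiableWithinAt)
    (fun z hz => hRH.riemannZeta_ne_zero (by linarith [(hball z hz).1]) (hne1 z hz)) ?_ hs
  · refine h.trans (le_of_eq ?_)
    ring
  · intro z hz
    obtain ⟨h1, h2, h3⟩ := hball z hz
    have h4 := hζ z (by linarith) h2.le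
    have h5 : Real.log (3 * K + 1) + K₂ + Real.log t ≤ A * Real.log t := by
      rw [hA]
      nlinarith
    calc ‖riemannZeta z‖ ≤ K * (3 * t) := h4.trans (by gcongr)
      _ ≤ (3 * K + 1) * t := by nlinarith
      _ ≤ (‖riemannZeta (2 + I * t)‖ * Real.exp K₂) * ((3 * K + 1) * t) :=
        le_mul_of_one_le_left (by positivity) (hζ₂ t)
      _ = ‖riemannZeta (2 + I * t)‖ * Real.exp (Real.log (3 * K + 1) + K₂ + Real.log t) := by
        rw [Real.exp_add, Real.exp_add, Real.exp_log (by linarith), Real.exp_log (by linarith)]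
        ring
      _ ≤ _ := by gcongr

/-- On the Riemann hypothesis `ζ' / ζ` is `O(L)` in the strip `1 ≤ re s ≤ 1 + 1 / L` at height
about `exp (exp L)`. The three circles have radii `1 - 1 / L`, where `ζ' / ζ` is `O(L)`, and
`7 / 6`, where it is `O(exp L)`; the latter bound enters with an exponent `O(1 / L)`. -/
lemma RiemannHypothesis.exists_norm_logDeriv_le (hRH : RiemannHypothesis) :
    ∃ C L₀ : ℝ, 2 ≤ L₀ ∧ ∀ L : ℝ, L₀ ≤ L → ∀ t : ℝ, 3 ≤ t → Real.log t ≤ 2 * Real.exp L →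
      ∀ σ : ℝ, 1 ≤ σ → σ ≤ 1 + 1 / L → ‖logDeriv riemannZeta (σ + I * t)‖ ≤ C * L := by
  obtain ⟨C, hC, hb⟩ := hRH.exists_norm_logDeriv_le_log
  obtain ⟨η₀, hη₀, ha⟩ := exists_norm_logDeriv_riemannZeta_le_of_one_add_le
  set k : ℝ := 2 / Real.log (7 / 6) with hk
  have hlog76 : 0 < Real.log (7 / 6) := Real.log_pos (by norm_num)
  refine ⟨2 * Real.exp (2 * k), max (max 2 (2 / η₀)) (Real.log (2 * C)),
    (le_max_left _ _).trans (le_max_left _ _), fun L hL t ht htL σ hσ hσ' => ?_⟩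
  have hL2 : 2 ≤ L := ((le_max_left _ _).trans (le_max_left _ _)).trans hL
  have hLη : 2 / η₀ ≤ L := ((le_max_right _ _).trans (le_max_left _ _)).trans hL
  have hLC : Real.log (2 * C) ≤ L := (le_max_right _ _).trans hL
  have hL0 : 0 < L := by linarith
  have hLinv : 1 / L ≤ 1 / 2 := one_div_le_one_div_of_le (by norm_num) hL2
  have hLinv0 : 0 < 1 / L := by positivity
  set c : ℂ := 2 + I * t with hc
  set z : ℂ := σ + I * t with hz
  have hzc : ‖z - c‖ = 2 - σ := by
    have : z - c = ((σ - 2 : ℝ) : ℂ) := by rw [hz, hc]; push_cast; ring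
    rw [this, norm_real, Real.norm_eq_abs, abs_of_neg (by linarith)]
    ring
  have hre : ∀ w : ℂ, 2 - ‖w - c‖ ≤ w.re := by
    intro w
    have := neg_le_of_abs_le (abs_re_le_norm (w - c))
    simp [hc] at this
    linarith
  have him : ∀ w : ℂ, t - ‖w - c‖ ≤ w.im := by
    intro w
    have := neg_le_of_abs_le (abs_im_le_norm (w - c))
    simp [hc] at this
    linarith
  have h := norm_le_of_three_circles (f := logDeriv riemannZeta) (c := c) (z := z)
    (r₁ := 1 - 1 / L) (r₂ := 7 / 6) (a := 2 * L) (b := C * (2 * Real.exp L))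
    (by linarith) (by linarith) ?_ ?_ ?_ (by rw [hzc]; linarith) (by rw [hzc]; linarith)
  · set θ := Real.log (‖z - c‖ / (1 - 1 / L)) / Real.log (7 / 6 / (1 - 1 / L)) with hθ
    have hr1 : 0 < 1 - 1 / L := by linarith
    have hnum0 : 0 ≤ Real.log (‖z - c‖ / (1 - 1 / L)) := by
      refine Real.log_nonneg ?_
      rw [one_le_div hr1, hzc]
      linarith
    have hden : Real.log (7 / 6) ≤ Real.log (7 / 6 / (1 - 1 / L)) := by
      refine Real.log_le_log (by norm_num) ?_
      rw [le_div_iff₀ hr1]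
      linarith
    have hnum : Real.log (‖z - c‖ / (1 - 1 / L)) ≤ 2 / L := by
      refine (Real.log_le_sub_one_of_pos (div_pos (by rw [hzc]; linarith) hr1)).trans ?_
      rw [hzc, sub_le_iff_le_add, div_le_iff₀ hr1]
      have : 2 / L = 2 * (1 / L) := by ring
      rw [this]
      nlinarith
    have hθ0 : 0 ≤ θ := div_nonneg hnum0 (hlog76.le.trans hden)
    have hθk : θ ≤ k / L := by
      calc θ ≤ (2 / L) / Real.log (7 / 6) := by exact div_le_div₀ (by positivity) hnum hlog76 hden
        _ = k / L := by rw [hk]; ring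
    have hb1 : 1 ≤ C * (2 * Real.exp L) := by
      have := Real.add_one_le_exp L
      nlinarith
    have hbb : C * (2 * Real.exp L) ≤ Real.exp (2 * L) := by
      have e : Real.exp (2 * L) = Real.exp L * Real.exp L := by rw [← Real.exp_add]; ring_nf
      have : 2 * C ≤ Real.exp L := (Real.log_le_iff_le_exp (by linarith)).mp hLC
      rw [e]
      nlinarith [Real.exp_pos L]
    -- As `θ = O(1 / L)`, the bound `exp (2 * L)` on the outer circle costs only a constant.
    have h1 : (2 * L) ^ (1 - θ) ≤ 2 * L := by
      calc (2 * L) ^ (1 - θ) ≤ (2 * L) ^ (1 : ℝ) :=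
            Real.rpow_le_rpow_of_exponent_le (by linarith) (by linarith)
        _ = 2 * L := Real.rpow_one _
    have h2 : (C * (2 * Real.exp L)) ^ θ ≤ Real.exp (2 * k) := by
      calc (C * (2 * Real.exp L)) ^ θ ≤ (Real.exp (2 * L)) ^ θ :=
            Real.rpow_le_rpow (by linarith) hbb hθ0
        _ = Real.exp (2 * L * θ) := (Real.exp_mul _ _).symm
        _ ≤ Real.exp (2 * k) := by
          rw [Real.exp_le_exp]
          have := (le_div_iff₀ hL0).mp hθk
          linarith
    calc _ ≤ _ := h
      _ ≤ 2 * L * Real.exp (2 * k) := by gcongr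
      _ = _ := by ring
  · intro w hw
    have hw' : ‖w - c‖ ≤ 7 / 6 := by simpa [dist_eq_norm] using hw
    have hw1 : w ≠ 1 := by
      rintro rfl
      have := him 1
      simp only [one_im] at this
      linarith
    have hana : AnalyticAt ℂ riemannZeta w :=
      (differentiableOn_riemannZeta.analyticOnNhd isOpen_compl_singleton) w hw1
    exact hana.deriv.differentiableAt.div hana.differentiableAt
      (hRH.riemannZeta_ne_zero (by linarith [hre w]) hw1)
  · intro w hw
    have hw' : ‖w - c‖ = 1 - 1 / L := by simpa [dist_eq_norm] using hw
    have := ha (1 / L) hLinv0 ?_ w (by linarith [hre w])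
    · simpa using this
    · rw [div_le_iff₀ hη₀] at hLη
      rw [div_lt_iff₀ hL0]
      linarith
  · intro w hw
    refine (hb t ht w (Metric.sphere_subset_closedBall hw)).trans ?_
    gcongr

/-- On the Riemann hypothesis, moving from the line `re s = 1` to the right by `1 / log log t`
changes `|ζ|` at most by a constant factor. -/
lemma RiemannHypothesis.exists_norm_riemannZeta_compare (hRH : RiemannHypothesis) :
    ∃ C L₀ : ℝ, 2 ≤ L₀ ∧ ∀ L : ℝ, L₀ ≤ L → ∀ t : ℝ, 3 ≤ t → Real.log t ≤ 2 * Real.exp L →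
      |Real.log ‖riemannZeta (1 + I * t)‖ -
        Real.log ‖riemannZeta ((1 + 1 / L : ℝ) + I * t)‖| ≤ C := by
  obtain ⟨C, L₀, hL₀, hb⟩ := hRH.exists_norm_logDeriv_le
  refine ⟨C, L₀, hL₀, fun L hL t ht htL => ?_⟩
  have hL0 : 0 < L := by linarith
  have hLinv : 1 / L ≤ 1 / 2 := one_div_le_one_div_of_le (by norm_num) (by linarith)
  have hLinv0 : 0 < 1 / L := by positivity
  set c : ℂ := 2 + I * t with hc
  have hne1 : ∀ z ∈ Metric.ball c (4 / 3), z ≠ 1 := by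
    rintro z hz rfl
    rw [Metric.mem_ball, dist_eq_norm] at hz
    have h2 := le_of_abs_le (abs_im_le_norm (c - 1))
    rw [norm_sub_rev] at h2
    simp [hc] at h2
    linarith
  have hne0 : ∀ z ∈ Metric.ball c (4 / 3), riemannZeta z ≠ 0 := by
    intro z hz
    refine hRH.riemannZeta_ne_zero ?_ (hne1 z hz)
    rw [Metric.mem_ball, dist_eq_norm] at hz
    have := neg_le_of_abs_le (abs_re_le_norm (z - c))
    simp [hc] at this
    linarith
  -- Integrate the bound `O(L)` for `ζ' / ζ` over a segment of length `1 / L`.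
  obtain ⟨g, -, hg⟩ := exists_eq_mul_exp_of_ball (f := riemannZeta) (c := c) (R := 4 / 3)
    (by norm_num) (fun z hz => (differentiableAt_riemannZeta (hne1 z hz)).differentiableWithinAt)
    hne0
  have hmem : ∀ σ ∈ Icc (1 : ℝ) (1 + 1 / L), (σ + I * t : ℂ) ∈ Metric.ball c (4 / 3) := by
    intro σ hσ
    have : (σ + I * t : ℂ) - c = ((σ - 2 : ℝ) : ℂ) := by rw [hc]; push_cast; ring
    rw [Metric.mem_ball, dist_eq_norm, this, norm_real, Real.norm_eq_abs, abs_lt]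
    constructor <;> linarith [hσ.1, hσ.2]
  have hlog : ∀ z ∈ Metric.ball c (4 / 3),
      Real.log ‖riemannZeta z‖ = Real.log ‖riemannZeta c‖ + (g z).re := by
    intro z hz
    have hc0 : ‖riemannZeta c‖ ≠ 0 :=
      norm_ne_zero_iff.mpr (hne0 c (Metric.mem_ball_self (by norm_num)))
    rw [(hg z hz).2, norm_mul, norm_exp, Real.log_mul hc0 (Real.exp_ne_zero _), Real.log_exp]
  have hmv := Convex.norm_image_sub_le_of_norm_hasDerivWithin_le (𝕜 := ℝ)
    (f := fun σ : ℝ => g (σ + I * t)) (f' := fun σ : ℝ => logDeriv riemannZeta (σ + I * t))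
    (s := Icc 1 (1 + 1 / L)) (C := C * L) (x := 1 + 1 / L) (y := 1)
    (fun σ hσ => ?_) (fun σ hσ => hb L hL t ht htL σ hσ.1 hσ.2) (convex_Icc _ _)
    ⟨by linarith, le_rfl⟩ ⟨le_rfl, by linarith⟩
  · have e1 : (1 + I * t : ℂ) = ((1 : ℝ) : ℂ) + I * t := by simp
    rw [e1, hlog _ (hmem 1 ⟨le_rfl, by linarith⟩), hlog _ (hmem (1 + 1 / L) ⟨by linarith, le_rfl⟩),
      add_sub_add_left_eq_sub, ← sub_re]
    refine (abs_re_le_norm _).trans (hmv.trans (le_of_eq ?_))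
    rw [sub_add_cancel_left, norm_neg, Real.norm_of_nonneg hLinv0.le]
    field_simp
  · have h1 := (hg _ (hmem σ hσ)).1
    have h2 : HasDerivAt (fun σ : ℝ => (σ + I * t : ℂ)) 1 σ :=
      (Complex.ofRealCLM.hasDerivAt (x := σ)).add_const (I * t : ℂ)
    have := HasDerivAt.scomp σ h1 h2
    simpa [Function.comp_def] using this.hasDerivWithinAt

/-! ### The majorant principle -/

/-- The function `(x, y) ↦ exp (i μ (x - y))` is positive definite. -/
lemma integral_prod_exp_sub (κ : Measure ℝ) [IsFiniteMeasure κ] (μ : ℝ) :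
    ∫ z, exp (I * μ * ((z.1 - z.2 : ℝ) : ℂ)) ∂(κ.prod κ) =
      ((‖∫ x, exp (I * μ * (x : ℂ)) ∂κ‖ ^ 2 : ℝ) : ℂ) := by
  have h1 : ∀ z : ℝ × ℝ, exp (I * μ * ((z.1 - z.2 : ℝ) : ℂ)) =
      exp (I * μ * (z.1 : ℂ)) * (starRingEnd ℂ) (exp (I * μ * (z.2 : ℂ))) := by
    intro z
    rw [← exp_conj, ← exp_add]
    congr 1
    simp only [map_mul, conj_I, conj_ofReal]
    push_cast
    ring
  simp_rw [h1]
  rw [integral_prod_mul (fun x : ℝ => exp (I * μ * (x : ℂ)))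
    (fun y : ℝ => (starRingEnd ℂ) (exp (I * μ * (y : ℂ)))), integral_conj, mul_conj,
    normSq_eq_norm_sq]

/-- The mean over differences of a power of a trigonometric sum is a nonnegative combination of the
products of its coefficients. -/
lemma integral_prod_trigSum_pow {ι : Type*} [Fintype ι] (κ : Measure ℝ) [IsFiniteMeasure κ]
    (a : ι → ℂ) (μ : ι → ℝ) (k : ℕ) :
    ∫ z, (∑ j, a j * exp (I * μ j * ((z.1 - z.2 : ℝ) : ℂ))) ^ k ∂(κ.prod κ) =
      ∑ q : Fin k → ι, (∏ i, a (q i)) *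
        ((‖∫ x, exp (I * (∑ i, μ (q i) : ℝ) * (x : ℂ)) ∂κ‖ ^ 2 : ℝ) : ℂ) := by
  have h1 : ∀ z : ℝ × ℝ, (∑ j, a j * exp (I * μ j * ((z.1 - z.2 : ℝ) : ℂ))) ^ k =
      ∑ q : Fin k → ι, (∏ i, a (q i)) * exp (I * (∑ i, μ (q i) : ℝ) * ((z.1 - z.2 : ℝ) : ℂ)) := by
    intro z
    rw [Fintype.sum_pow]
    refine Finset.sum_congr rfl fun q _ => ?_
    rw [Finset.prod_mul_distrib, ← exp_sum, ofReal_sum, Finset.mul_sum, Finset.sum_mul]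
  simp_rw [h1]
  rw [integral_finsetSum]
  · refine Finset.sum_congr rfl fun q _ => ?_
    rw [integral_const_mul, integral_prod_exp_sub]
  · intro q _
    refine Integrable.const_mul (Integrable.of_bound (C := 1) (by fun_prop) ?_) _
    filter_upwards with z
    rw [norm_exp]
    simp

/-- The majorant principle for powers: the coefficients of a power of a trigonometric sum are
dominated by those of the same power of a majorant. -/
lemma norm_integral_prod_trigSum_pow_le {ι : Type*} [Fintype ι] (κ : Measure ℝ)
    [IsFiniteMeasure κ] {a : ι → ℂ} {b : ι → ℝ} (hab : ∀ j, ‖a j‖ ≤ b j) (μ : ι → ℝ) (k : ℕ) :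
    ‖∫ z, (∑ j, a j * exp (I * μ j * ((z.1 - z.2 : ℝ) : ℂ))) ^ k ∂(κ.prod κ)‖ ≤
      (∫ z, (∑ j, (b j : ℂ) * exp (I * μ j * ((z.1 - z.2 : ℝ) : ℂ))) ^ k ∂(κ.prod κ)).re := by
  rw [integral_prod_trigSum_pow, integral_prod_trigSum_pow, re_sum]
  refine norm_sum_le_of_le _ fun q _ => ?_
  rw [← ofReal_prod, ← ofReal_mul, ofReal_re, norm_mul, norm_real, norm_prod,
    Real.norm_of_nonneg (by positivity)]
  gcongr
  exact hab _

lemma hasSum_integral_exp {α : Type*} [MeasurableSpace α] {ν : Measure α} [IsFiniteMeasure ν]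
    {F : α → ℝ} (hF : AEStronglyMeasurable F ν) {B : ℝ} (hB : ∀ x, |F x| ≤ B) :
    HasSum (fun k : ℕ => ∫ x, F x ^ k / k.factorial ∂ν) (∫ x, Real.exp (F x) ∂ν) := by
  have hbound : ∀ k : ℕ, ∀ x, ‖F x ^ k / k.factorial‖ ≤ B ^ k / k.factorial := by
    intro k x
    rw [norm_div, norm_pow, Real.norm_natCast, Real.norm_eq_abs]
    gcongr
    exact hB x
  have h := hasSum_integral_of_summable_integral_norm (μ := ν)
    (F := fun (k : ℕ) x => F x ^ k / k.factorial)
    (fun k => Integrable.of_bound (C := B ^ k / k.factorial) (by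
      simpa only [div_eq_mul_inv] using! (hF.pow k).mul_const _)
      (Eventually.of_forall (hbound k))) ?_
  · simpa only [Real.exp_eq_exp_ℝ, NormedSpace.exp_eq_tsum_div] using h
  · refine Summable.of_nonneg_of_le (fun k => integral_nonneg fun x => norm_nonneg _) (fun k => ?_)
      ((Real.summable_pow_div_factorial B).mul_left (ν.real univ))
    have := norm_integral_le_of_norm_le_const (μ := ν) (f := fun x => ‖F x ^ k / k.factorial‖)
      (C := B ^ k / k.factorial) (Eventually.of_forall fun x => by rw [norm_norm]; exact hbound k x)
    rw [mul_comm]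
    exact (Real.le_norm_self _).trans this

/-- The majorant principle for exponentials: in the mean over differences with respect to `κ`, the
exponential of a real trigonometric polynomial with coefficients at most `c` in absolute value is
largest when all phases are aligned at the origin. -/
lemma integral_prod_exp_trigPoly_le (κ : Measure ℝ) [IsFiniteMeasure κ] (S : Finset ℕ)
    {c : ℕ → ℝ} (hc : ∀ n, 0 ≤ c n) {w : ℕ → ℂ} (hw : ∀ n, ‖w n‖ ≤ 1) (l : ℕ → ℝ) :
    ∫ z, Real.exp (∑ n ∈ S, c n * (w n * exp (I * l n * ((z.1 - z.2 : ℝ) : ℂ))).re) ∂(κ.prod κ) ≤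
      ∫ z, Real.exp (∑ n ∈ S, c n * (exp (I * l n * ((z.1 - z.2 : ℝ) : ℂ))).re) ∂(κ.prod κ) := by
  -- Twice the real part is a sum of two exponentials, indexed by the sign of the frequency.
  let μ : S × Bool → ℝ := fun j => if j.2 then l j.1 else -l j.1
  let a (v : ℕ → ℂ) : S × Bool → ℂ :=
    fun j => c j.1 / 2 * if j.2 then v j.1 else (starRingEnd ℂ) (v j.1)
  have hre : ∀ v : ℕ → ℂ, ∀ u : ℝ,
      ((∑ n ∈ S, c n * (v n * exp (I * l n * (u : ℂ))).re : ℝ) : ℂ) =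
        ∑ j, a v j * exp (I * μ j * (u : ℂ)) := by
    intro v u
    rw [Fintype.sum_prod_type, ← Finset.sum_coe_sort S]
    push_cast
    refine Finset.sum_congr rfl fun n _ => ?_
    rw [Fintype.sum_bool, re_eq_add_conj]
    simp only [a, μ, if_true, Bool.false_eq_true, if_false, map_mul, ← exp_conj, conj_I,
      conj_ofReal]
    push_cast
    ring_nf
  have hbd : ∀ v : ℕ → ℂ, (∀ n, ‖v n‖ ≤ 1) → ∀ u : ℝ,
      |∑ n ∈ S, c n * (v n * exp (I * l n * (u : ℂ))).re| ≤ ∑ n ∈ S, c n := by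
    intro v hv u
    refine (Finset.abs_sum_le_sum_abs _ _).trans (Finset.sum_le_sum fun n _ => ?_)
    rw [abs_mul, abs_of_nonneg (hc n)]
    refine mul_le_of_le_one_right (hc n) ((abs_re_le_norm _).trans ?_)
    rw [norm_mul, norm_exp]
    simpa using hv n
  have hmeas : ∀ v : ℕ → ℂ, AEStronglyMeasurable (fun z : ℝ × ℝ =>
      ∑ n ∈ S, c n * (v n * exp (I * l n * ((z.1 - z.2 : ℝ) : ℂ))).re) (κ.prod κ) := by
    intro v
    refine Continuous.aestronglyMeasurable ?_
    fun_prop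
  have h1 := hasSum_integral_exp (hmeas w) (fun z => hbd w hw (z.1 - z.2))
  have h2 := hasSum_integral_exp (hmeas 1) (fun z => hbd 1 (by simp) (z.1 - z.2))
  simp only [Pi.one_apply, one_mul] at h2
  refine hasSum_le (fun k => ?_) h1 h2
  rw [integral_div, integral_div]
  refine div_le_div_of_nonneg_right ?_ (by positivity)
  have hint : ∀ v : ℕ → ℂ,
      ((∫ z : ℝ × ℝ, (∑ n ∈ S, c n * (v n * exp (I * l n * ((z.1 - z.2 : ℝ) : ℂ))).re) ^ k
        ∂(κ.prod κ) : ℝ) : ℂ) =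
      ∫ z, (∑ j, a v j * exp (I * μ j * ((z.1 - z.2 : ℝ) : ℂ))) ^ k ∂(κ.prod κ) := by
    intro v
    rw [← integral_complex_ofReal]
    refine integral_congr_ae (Eventually.of_forall fun z => ?_)
    simp only [← hre]
    exact ofReal_pow _ _
  have h3 := norm_integral_prod_trigSum_pow_le κ (a := a w) (b := fun j => c j.1 / 2) ?_ μ k
  · rw [← hint w, norm_real] at h3
    refine (Real.le_norm_self _).trans (h3.trans (le_of_eq ?_))
    have h4 := hint 1
    simp only [Pi.one_apply, one_mul] at h4
    rw [← ofReal_re (∫ z : ℝ × ℝ, _ ∂(κ.prod κ)), h4]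
    congr 1
    refine integral_congr_ae (Eventually.of_forall fun z => ?_)
    simp [a]
  · intro j
    have : ‖if j.2 then w j.1 else (starRingEnd ℂ) (w j.1)‖ ≤ 1 := by
      split_ifs
      · exact hw _
      · simpa using hw _
    simp only [a]
    rw [norm_mul, norm_div, norm_real, Real.norm_of_nonneg (hc _)]
    simpa using mul_le_of_le_one_right (div_nonneg (hc j.1) (by norm_num : (0 : ℝ) ≤ 2)) this

/-! ### Transfer of short moments to the real axis -/

/-- `log |ζ|` on the line `re s = σ > 1` is a trigonometric polynomial with nonnegative
coefficients, up to an error of at most `1`. -/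
lemma exists_trigPoly_approx_log_norm_riemannZeta {σ : ℝ} (hσ : 1 < σ) :
    ∃ (S : Finset ℕ) (c : ℕ → ℝ), (∀ n, 0 ≤ c n) ∧ ∀ u : ℝ,
      |Real.log ‖riemannZeta (σ + I * u)‖ -
        ∑ n ∈ S, c n * (exp (I * (Real.log n : ℝ) * u)).re| ≤ 1 := by
  set f : ℕ → ℂ := fun n => (logZetaCoeff n : ℂ) with hf
  have hre : ∀ u : ℝ, (σ + I * u : ℂ).re = σ := fun u => by simp
  have hsum : Summable fun n => ‖LSeries.term f σ n‖ :=
    (lseriesSummable_logZetaCoeff (s := σ) (by simpa using hσ)).norm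
  obtain ⟨S, hS⟩ := ((tendsto_tsum_compl_atTop_zero fun n => ‖LSeries.term f σ n‖).eventually
    (eventually_le_nhds zero_lt_one)).exists
  refine ⟨S, fun n => ‖LSeries.term f σ n‖, fun n => norm_nonneg _, fun u => ?_⟩
  have hterm : ∀ n, (LSeries.term f (σ + I * u) n).re =
      ‖LSeries.term f σ n‖ * (exp (I * (Real.log n : ℝ) * u)).re := by
    intro n
    rcases eq_or_ne n 0 with rfl | hn
    · simp
    · have hn0 : (n : ℂ) ≠ 0 := by exact_mod_cast hn
      have h1 : LSeries.term f (σ + I * u) n =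
          (‖LSeries.term f σ n‖ : ℝ) * exp (-(I * (Real.log n : ℝ) * u)) := by
        rw [LSeries.norm_term_eq, if_neg hn, LSeries.term_of_ne_zero hn, cpow_add _ _ hn0,
          ofReal_re, hf, norm_real, Real.norm_of_nonneg (logZetaCoeff_nonneg n), ofReal_div,
          ofReal_cpow n.cast_nonneg, ofReal_natCast, cpow_def_of_ne_zero hn0 (I * u), exp_neg,
          natCast_log, div_mul_eq_div_div, div_eq_mul_inv (_ / _)]
        ring_nf
      rw [h1, re_ofReal_mul, exp_re, exp_re]
      simp [-natCast_log]
  have hsum' : Summable fun n => LSeries.term f (σ + I * u) n :=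
    lseriesSummable_logZetaCoeff (by rwa [hre])
  rw [norm_riemannZeta_eq_exp (by rwa [hre]), Real.log_exp, LSeries,
    ← hsum'.sum_add_tsum_subtype_compl S, add_re, re_sum]
  simp_rw [hterm]
  rw [add_sub_cancel_left]
  refine (abs_re_le_norm _).trans (le_trans ?_ hS)
  refine tsum_of_norm_bounded (hsum.subtype _).hasSum fun n => ?_
  exact LSeries.norm_term_le_of_re_le_re _ (by rw [hre]; simp) _

section DifferenceMeans

variable {g : ℝ → ℝ} {δ : ℝ}

lemma integrable_prod_sub (hg : Continuous g) (T : ℝ) :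
    Integrable (fun z : ℝ × ℝ => g (z.1 - z.2 + T))
      ((volume.restrict (Icc 0 (2 * δ))).prod (volume.restrict (Icc 0 (2 * δ)))) := by
  rw [Measure.prod_restrict]
  refine ContinuousOn.integrableOn_compact (isCompact_Icc.prod isCompact_Icc) ?_
  fun_prop

lemma setIntegral_sub_eq (hδ : 0 < δ) (T y : ℝ) :
    ∫ x in Icc 0 (2 * δ), g (x - y + T) = ∫ u in (T - y)..(2 * δ + (T - y)), g u := by
  rw [integral_Icc_eq_integral_Ioc, ← intervalIntegral.integral_of_le (by linarith)]
  have := intervalIntegral.integral_comp_add_right (a := 0) (b := 2 * δ) g (T - y)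
  rw [zero_add] at this
  rw [← this]
  congr 1
  ext x
  congr 1
  ring

/-- The mean of `g (x - y + T)` over a square of side `2 δ` controls the integral of `g` over
`[T, T + δ]`, because for `y ≤ δ` that interval is swept out by `x ∈ [0, 2 δ]`. -/
lemma mul_intervalIntegral_le_integral_prod_sub (hg : Continuous g) (hg0 : ∀ u, 0 ≤ g u)
    (hδ : 0 < δ) (T : ℝ) :
    δ * ∫ u in T..(T + δ), g u ≤ ∫ z, g (z.1 - z.2 + T)
      ∂((volume.restrict (Icc 0 (2 * δ))).prod (volume.restrict (Icc 0 (2 * δ)))) := by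
  have hint := integrable_prod_sub (δ := δ) hg T
  rw [integral_prod_symm _ hint]
  have hφ := hint.integral_prod_right
  have hsub : Icc 0 δ ⊆ Icc 0 (2 * δ) := Icc_subset_Icc le_rfl (by linarith)
  calc δ * ∫ u in T..(T + δ), g u = ∫ _ in Icc 0 δ, ∫ u in T..(T + δ), g u := by
        simp [hδ.le]
    _ ≤ ∫ y in Icc 0 δ, ∫ x in Icc 0 (2 * δ), g (x - y + T) := by
        refine setIntegral_mono_on (integrable_const _) (IntegrableOn.mono_set hφ hsub)
          measurableSet_Icc fun y hy => ?_
        rw [setIntegral_sub_eq hδ]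
        exact intervalIntegral.integral_mono_interval (by linarith [hy.1]) (by linarith)
          (by linarith [hy.2]) (Eventually.of_forall hg0) (hg.intervalIntegrable _ _)
    _ ≤ ∫ y in Icc 0 (2 * δ), ∫ x in Icc 0 (2 * δ), g (x - y + T) :=
        setIntegral_mono_set hφ (Eventually.of_forall fun y => integral_nonneg fun x => hg0 _)
          hsub.eventuallyLE

lemma integral_prod_sub_le_mul_intervalIntegral (hg : Continuous g) (hg0 : ∀ u, 0 ≤ g u)
    (hδ : 0 < δ) :
    ∫ z, g (z.1 - z.2)
      ∂((volume.restrict (Icc 0 (2 * δ))).prod (volume.restrict (Icc 0 (2 * δ)))) ≤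
      2 * δ * ∫ u in (-(2 * δ))..(2 * δ), g u := by
  have hint := integrable_prod_sub (δ := δ) hg 0
  simp only [add_zero] at hint
  rw [integral_prod_symm _ hint]
  calc ∫ y in Icc 0 (2 * δ), ∫ x in Icc 0 (2 * δ), g (x - y)
      ≤ ∫ _ in Icc 0 (2 * δ), ∫ u in (-(2 * δ))..(2 * δ), g u := by
        refine setIntegral_mono_on hint.integral_prod_right (integrable_const _) measurableSet_Icc
          fun y hy => ?_
        have := setIntegral_sub_eq (g := g) hδ 0 y
        simp only [add_zero, zero_sub] at this
        rw [this]
        exact intervalIntegral.integral_mono_interval (by linarith [hy.2]) (by linarith)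
          (by linarith [hy.1]) (Eventually.of_forall hg0) (hg.intervalIntegrable _ _)
    _ = _ := by simp [hδ.le]

end DifferenceMeans

lemma continuous_norm_riemannZeta_rpow {σ : ℝ} (hσ : 1 < σ) (q : ℝ) :
    Continuous fun u : ℝ => ‖riemannZeta (σ + I * u)‖ ^ q := by
  refine continuous_iff_continuousAt.mpr fun u => ?_
  have hre : (σ + I * u : ℂ).re = σ := by simp
  have h1 : (σ + I * u : ℂ) ≠ 1 := by
    intro h
    rw [h, one_re] at hre
    linarith
  have h0 := riemannZeta_ne_zero_of_one_le_re (s := σ + I * u) (by rw [hre]; exact hσ.le)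
  have h2 : ContinuousAt (fun u : ℝ => riemannZeta (σ + I * u)) u :=
    (differentiableAt_riemannZeta h1).continuousAt.comp (f := fun u : ℝ => (σ + I * u : ℂ))
      (by fun_prop)
  exact h2.norm.rpow_const (Or.inl (norm_ne_zero_iff.mpr h0))

/-- The mean of any real power of `|ζ|` over a short interval on a line `re s = σ > 1` is dominated
by the mean over an interval around the real axis, with a constant independent of `σ` and `T`. -/
lemma integral_norm_riemannZeta_rpow_le {σ δ : ℝ} (hσ : 1 < σ) (hδ : 0 < δ) (q T : ℝ) :
    ∫ u in T..(T + δ), ‖riemannZeta (σ + I * u)‖ ^ q ≤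
      2 * Real.exp (2 * |q|) *
        ∫ u in (-(2 * δ))..(2 * δ), ‖riemannZeta (σ + I * u)‖ ^ |q| := by
  obtain ⟨S, c, hc, hS⟩ := exists_trigPoly_approx_log_norm_riemannZeta hσ
  set P : ℝ → ℝ := fun u => ∑ n ∈ S, c n * (exp (I * (Real.log n : ℝ) * u)).re with hP
  have hPc : Continuous P := by rw [hP]; fun_prop
  have hpos : ∀ u : ℝ, 0 < ‖riemannZeta (σ + I * u)‖ := fun u =>
    norm_pos_iff.mpr (riemannZeta_ne_zero_of_one_le_re (by simpa using hσ.le))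
  have hrpow : ∀ u r : ℝ, ‖riemannZeta (σ + I * u)‖ ^ r =
      Real.exp (r * Real.log ‖riemannZeta (σ + I * u)‖) := fun u r => by
    rw [Real.rpow_def_of_pos (hpos u), mul_comm]
  have hup : ∀ u : ℝ, ‖riemannZeta (σ + I * u)‖ ^ q ≤ Real.exp |q| * Real.exp (q * P u) := by
    intro u
    rw [hrpow, ← Real.exp_add, Real.exp_le_exp]
    have h1 : |q * (Real.log ‖riemannZeta (σ + I * u)‖ - P u)| ≤ |q| * 1 := by
      rw [abs_mul]
      gcongr
      exact hS u
    linarith [le_of_abs_le h1]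
  have hlow : ∀ u : ℝ, Real.exp (|q| * P u) ≤
      Real.exp |q| * ‖riemannZeta (σ + I * u)‖ ^ |q| := by
    intro u
    rw [hrpow, ← Real.exp_add, Real.exp_le_exp]
    have h1 := neg_le_of_abs_le (hS u)
    nlinarith [abs_nonneg q]
  -- The twist by `T` and, for `q < 0`, the change of sign are absorbed into the phases.
  have hmaj := integral_prod_exp_trigPoly_le (volume.restrict (Icc 0 (2 * δ))) S
    (c := fun n => |q| * c n) (fun n => mul_nonneg (abs_nonneg q) (hc n))
    (w := fun n => SignType.sign q * exp (I * (Real.log n : ℝ) * T)) (fun n => by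
      rw [norm_mul, norm_exp]
      rcases lt_trichotomy q 0 with h | h | h <;> simp [-natCast_log, h])
    (fun n => Real.log n)
  have e1 : ∀ v : ℝ, ∑ n ∈ S, |q| * c n * (SignType.sign q * exp (I * (Real.log n : ℝ) * T) *
      exp (I * (Real.log n : ℝ) * v)).re = q * P (v + T) := by
    intro v
    rw [hP, Finset.mul_sum]
    refine Finset.sum_congr rfl fun n _ => ?_
    have h2 : SignType.sign q * exp (I * (Real.log n : ℝ) * T) * exp (I * (Real.log n : ℝ) * v) =
        ((SignType.sign q : ℝ) : ℂ) * exp (I * (Real.log n : ℝ) * ((v + T : ℝ) : ℂ)) := by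
      rw [mul_assoc, ← exp_add]
      congr 2
      · rcases lt_trichotomy q 0 with h | h | h <;> simp [h]
      · push_cast
        ring
    rw [h2, re_ofReal_mul]
    have h3 : |q| * (SignType.sign q : ℝ) = q := abs_mul_sign q
    linear_combination c n * (exp (I * (Real.log n : ℝ) * ((v + T : ℝ) : ℂ))).re * h3
  have e2 : ∀ v : ℝ, ∑ n ∈ S, |q| * c n * (exp (I * (Real.log n : ℝ) * v)).re = |q| * P v := by
    intro v
    rw [hP, Finset.mul_sum]
    exact Finset.sum_congr rfl fun n _ => mul_assoc _ _ _
  simp only [e1, e2] at hmaj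
  have hA := mul_intervalIntegral_le_integral_prod_sub (g := fun u => Real.exp (q * P u))
    (by fun_prop) (fun u => (Real.exp_pos _).le) hδ T
  have hB := integral_prod_sub_le_mul_intervalIntegral (g := fun u => Real.exp (|q| * P u))
    (by fun_prop) (fun u => (Real.exp_pos _).le) hδ
  have hAB : ∫ u in T..(T + δ), Real.exp (q * P u) ≤
      2 * ∫ u in (-(2 * δ))..(2 * δ), Real.exp (|q| * P u) := by
    have := hA.trans (hmaj.trans hB)
    refine le_of_mul_le_mul_left (this.trans (le_of_eq ?_)) hδ
    ring
  have h1 : ∫ u in T..(T + δ), ‖riemannZeta (σ + I * u)‖ ^ q ≤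
      Real.exp |q| * ∫ u in T..(T + δ), Real.exp (q * P u) := by
    rw [← intervalIntegral.integral_const_mul]
    exact intervalIntegral.integral_mono_on (by linarith)
      ((continuous_norm_riemannZeta_rpow hσ q).intervalIntegrable _ _)
      (Continuous.intervalIntegrable (by fun_prop) _ _) fun u _ => hup u
  have h2 : ∫ u in (-(2 * δ))..(2 * δ), Real.exp (|q| * P u) ≤
      Real.exp |q| * ∫ u in (-(2 * δ))..(2 * δ), ‖riemannZeta (σ + I * u)‖ ^ |q| := by
    rw [← intervalIntegral.integral_const_mul]
    exact intervalIntegral.integral_mono_on (by linarith)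
      (Continuous.intervalIntegrable (by fun_prop) _ _)
      (((continuous_norm_riemannZeta_rpow hσ |q|).const_mul _).intervalIntegrable _ _)
      fun u _ => hlow u
  have h3 : Real.exp (2 * |q|) = Real.exp |q| * Real.exp |q| := by
    rw [← Real.exp_add]
    ring_nf
  calc _ ≤ Real.exp |q| * (2 * (Real.exp |q| *
        ∫ u in (-(2 * δ))..(2 * δ), ‖riemannZeta (σ + I * u)‖ ^ |q|)) :=
        h1.trans (by gcongr; exact hAB.trans (by gcongr))
    _ = _ := by rw [h3]; ring

/-! ### Moments near the pole -/

/-- Near the pole, `|ζ|` is bounded by a multiple of `1 / |s - 1|`, so that its moments of order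
`p > 1` on the line `re s = 1 + η` are `O(η ^ (1 - p))`. -/
lemma exists_integral_norm_riemannZeta_rpow_le {p : ℝ} (hp : 1 < p) {a : ℝ} (ha : 0 < a) :
    ∃ C : ℝ, 0 ≤ C ∧ ∀ η : ℝ, 0 < η → η ≤ 1 →
      ∫ u in (-a)..a, ‖riemannZeta ((1 + η : ℝ) + I * u)‖ ^ p ≤ C * η ^ (1 - p) := by
  obtain ⟨B, hB⟩ := ((isCompact_Icc (a := (0 : ℝ)) (b := 1)).prod
    (isCompact_Icc (a := -a) (b := a))).bddAbove_image
    (f := fun z : ℝ × ℝ => ‖riemannZeta₁ ((1 + z.1 : ℝ) + I * z.2)‖)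
    (Continuous.continuousOn (by
      have := differentiable_riemannZeta₁.continuous
      fun_prop))
  have hB' : ∀ η ∈ Icc (0 : ℝ) 1, ∀ u ∈ Icc (-a) a,
      ‖riemannZeta₁ ((1 + η : ℝ) + I * u)‖ ≤ B := fun η hη u hu => hB ⟨(η, u), ⟨hη, hu⟩, rfl⟩
  have hB0 : 0 ≤ B := (norm_nonneg _).trans
    (hB' 0 ⟨le_rfl, zero_le_one⟩ 0 ⟨by linarith, ha.le⟩)
  set h : ℝ → ℝ := fun v => (1 + ‖v‖ ^ 2) ^ (-p / 2) with hh
  have hint : Integrable h := integrable_rpow_neg_one_add_norm_sq (by simpa using hp)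
  have hh0 : ∀ v, 0 ≤ h v := fun v => by rw [hh]; positivity
  refine ⟨B ^ p * ∫ v, h v, mul_nonneg (Real.rpow_nonneg hB0 _) (integral_nonneg hh0),
    fun η hη hη1 => ?_⟩
  -- `|s - 1| = η * (1 + (u / η) ^ 2) ^ (1 / 2)`; rescaling by `η` then gives the power of `η`.
  have hpt : ∀ u ∈ Icc (-a) a, ‖riemannZeta ((1 + η : ℝ) + I * u)‖ ^ p ≤
      B ^ p * η ^ (-p) * h (u / η) := by
    intro u hu
    have hs1 : ((1 + η : ℝ) + I * u : ℂ) - 1 = η + I * u := by push_cast; ring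
    have hsq : ‖(η + I * u : ℂ)‖ = η * (1 + (u / η) ^ 2) ^ (1 / 2 : ℝ) := by
      have e : (η + I * u : ℂ) = ⟨η, u⟩ := by apply Complex.ext <;> simp
      rw [← Real.sqrt_eq_rpow, e, Complex.norm_def, normSq_mk]
      rw [show η * η + u * u = η ^ 2 * (1 + (u / η) ^ 2) by field_simp,
        Real.sqrt_mul (by positivity), Real.sqrt_sq hη.le]
    have hne : ((1 + η : ℝ) + I * u : ℂ) ≠ 1 := by
      rw [← sub_ne_zero, hs1]
      intro h0
      have := congrArg re h0
      simp at this
      linarith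
    rw [riemannZeta_eq_inv_sub_mul hne, hs1, norm_mul, norm_inv, hsq, mul_comm,
      Real.mul_rpow (norm_nonneg _) (by positivity), Real.inv_rpow (by positivity),
      Real.mul_rpow hη.le (by positivity), ← Real.rpow_mul (by positivity), mul_inv,
      ← Real.rpow_neg hη.le, ← Real.rpow_neg (by positivity), hh, mul_assoc]
    have e : -(1 / 2 * p) = -p / 2 := by ring
    simp only [e, Real.norm_eq_abs, sq_abs]
    gcongr
    exact hB' η ⟨hη.le, hη1⟩ u hu
  have hcomp : Integrable fun u => h (u / η) := hint.comp_div hη.ne'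
  calc ∫ u in (-a)..a, ‖riemannZeta ((1 + η : ℝ) + I * u)‖ ^ p
      ≤ ∫ u in (-a)..a, B ^ p * η ^ (-p) * h (u / η) :=
        intervalIntegral.integral_mono_on (by linarith)
          ((continuous_norm_riemannZeta_rpow (by linarith) p).intervalIntegrable _ _)
          (hcomp.const_mul _).intervalIntegrable hpt
    _ = B ^ p * η ^ (-p) * ∫ u in (-a)..a, h (u / η) := intervalIntegral.integral_const_mul _ _
    _ ≤ B ^ p * η ^ (-p) * ∫ u, h (u / η) := by
        gcongr
        rw [intervalIntegral.integral_of_le (by linarith)]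
        exact setIntegral_le_integral hcomp (Eventually.of_forall fun u => hh0 _)
    _ = B ^ p * (∫ v, h v) * η ^ (1 - p) := by
        rw [Measure.integral_comp_div, smul_eq_mul, abs_of_pos hη, Real.rpow_sub hη,
          Real.rpow_neg hη.le, Real.rpow_one]
        ring

/-! ### Moments on the line `re s = 1` -/

/-- On the Riemann hypothesis, all moments of order `q` with `|q| > 1` of `ζ(1 + i t)` over
intervals of fixed length are `O((log log T) ^ (|q| - 1))`. -/
lemma RiemannHypothesis.isBigO_integral_norm_riemannZeta_rpow (hRH : RiemannHypothesis) {δ q : ℝ}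
    (hδ : 0 < δ) (hq : 1 < |q|) :
    (fun T : ℝ => ∫ t in T..(T + δ), ‖riemannZeta (1 + I * (t : ℂ))‖ ^ q) =O[atTop]
      fun T : ℝ => Real.log (Real.log T) ^ (|q| - 1) := by
  obtain ⟨C, L₀, hL₀, hcmp⟩ := hRH.exists_norm_riemannZeta_compare
  obtain ⟨D, hD, hpole⟩ := exists_integral_norm_riemannZeta_rpow_le hq
    (by linarith : 0 < 2 * δ)
  have hloglog : Tendsto (fun T : ℝ => Real.log (Real.log T)) atTop atTop :=
    Real.tendsto_log_atTop.comp Real.tendsto_log_atTop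
  refine Asymptotics.IsBigO.of_bound
    (Real.exp (|q| * C) * (2 * Real.exp (2 * |q|) * D)) ?_
  filter_upwards [hloglog.eventually_ge_atTop L₀, eventually_ge_atTop (3 + δ)] with T hL hT
  set L := Real.log (Real.log T) with hLdef
  have hL0 : 0 < L := by linarith
  have hη : 0 < 1 / L := by positivity
  have hη1 : 1 / L ≤ 1 := by rw [div_le_one hL0]; linarith
  have hσ : 1 < 1 + 1 / L := by linarith
  have hlogT : 0 < Real.log T := Real.log_pos (by linarith)
  have hpt : ∀ t ∈ Icc T (T + δ), ‖riemannZeta (1 + I * t)‖ ^ q ≤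
      Real.exp (|q| * C) * ‖riemannZeta ((1 + 1 / L : ℝ) + I * t)‖ ^ q := by
    intro t ht
    have hlogt : Real.log t ≤ 2 * Real.exp L := by
      rw [hLdef, Real.exp_log hlogT]
      calc Real.log t ≤ Real.log (T ^ 2) := by
            refine Real.log_le_log (by linarith [ht.1]) (ht.2.trans ?_)
            nlinarith
        _ = 2 * Real.log T := by rw [Real.log_pow]; norm_num
    have h1 := hcmp L hL t (by linarith [ht.1]) hlogt
    have hne : riemannZeta (1 + I * t) ≠ 0 := riemannZeta_ne_zero_of_one_le_re (by simp)
    have hne' : riemannZeta ((1 + 1 / L : ℝ) + I * t) ≠ 0 :=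
      riemannZeta_ne_zero_of_one_le_re (by simpa using hL0.le)
    rw [Real.rpow_def_of_pos (norm_pos_iff.mpr hne), Real.rpow_def_of_pos (norm_pos_iff.mpr hne'),
      ← Real.exp_add, Real.exp_le_exp]
    have h2 : |(Real.log ‖riemannZeta (1 + I * t)‖ -
        Real.log ‖riemannZeta ((1 + 1 / L : ℝ) + I * t)‖) * q| ≤ C * |q| := by
      rw [abs_mul]
      gcongr
    linarith [le_of_abs_le h2]
  have hcont := (continuous_norm_riemannZeta_rpow hσ q)
  have hmono : ∫ t in T..(T + δ), ‖riemannZeta (1 + I * (t : ℂ))‖ ^ q ≤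
      Real.exp (|q| * C) *
        ∫ t in T..(T + δ), ‖riemannZeta ((1 + 1 / L : ℝ) + I * t)‖ ^ q := by
    rw [← intervalIntegral.integral_const_mul, intervalIntegral.integral_of_le (by linarith),
      intervalIntegral.integral_of_le (by linarith)]
    refine integral_mono_of_nonneg (Eventually.of_forall fun t => by positivity)
      ((hcont.const_mul _).integrableOn_Ioc) ?_
    filter_upwards [ae_restrict_mem measurableSet_Ioc] with t ht
    exact hpt t (Ioc_subset_Icc_self ht)
  have hpow : (1 / L) ^ (1 - |q|) = L ^ (|q| - 1) := by
    rw [one_div, Real.inv_rpow hL0.le, ← Real.rpow_neg hL0.le, neg_sub]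
  rw [Real.norm_of_nonneg (intervalIntegral.integral_nonneg (by linarith)
    fun t _ => by positivity), Real.norm_of_nonneg (by positivity)]
  calc _ ≤ _ := hmono
    _ ≤ Real.exp (|q| * C) * (2 * Real.exp (2 * |q|) * (D * (1 / L) ^ (1 - |q|))) := by
      gcongr
      refine (integral_norm_riemannZeta_rpow_le hσ hδ q T).trans ?_
      gcongr
      exact hpole _ hη hη1
    _ = _ := by rw [hpow]; ring

theorem theorem6 (hRH : RiemannHypothesis) (δ : ℝ) (hδ : 0 < δ) (p : ℝ) (hp : 1 < p) :
    Asymptotics.IsBigO Filter.atTop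
      (fun T : ℝ => ∫ t in T..(T + δ), ‖riemannZeta (1 + Complex.I * (t : ℂ))‖ ^ p)
      (fun T : ℝ => Real.log (Real.log (Real.log T)) * Real.log (Real.log T) ^ (p - 1)) ∧
    Asymptotics.IsBigO Filter.atTop
      (fun T : ℝ => ∫ t in T..(T + δ), ‖riemannZeta (1 + Complex.I * (t : ℂ))‖ ^ (-p))
      (fun T : ℝ => Real.log (Real.log (Real.log T)) * Real.log (Real.log T) ^ (p - 1)) := by
  have hp0 : |p| = p := abs_of_pos (by linarith)
  have hlog : (fun T : ℝ => Real.log (Real.log T) ^ (p - 1)) =O[atTop] fun T : ℝ =>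
      Real.log (Real.log (Real.log T)) * Real.log (Real.log T) ^ (p - 1) := by
    have h : Tendsto (fun T : ℝ => Real.log (Real.log (Real.log T))) atTop atTop :=
      Real.tendsto_log_atTop.comp (Real.tendsto_log_atTop.comp Real.tendsto_log_atTop)
    refine Asymptotics.IsBigO.of_bound 1 ?_
    filter_upwards [h.eventually_ge_atTop 1] with T hT
    rw [one_mul, norm_mul]
    exact le_mul_of_one_le_left (norm_nonneg _) (hT.trans (Real.le_norm_self _))
  have h1 := hRH.isBigO_integral_norm_riemannZeta_rpow (q := p) hδ (by rwa [hp0])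
  have h2 := hRH.isBigO_integral_norm_riemannZeta_rpow (q := -p) hδ (by rwa [abs_neg, hp0])
  rw [hp0] at h1
  rw [abs_neg, hp0] at h2
  exact ⟨h1.trans hlog, h2.trans hlog⟩
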